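/- Let $\mathbb D=\{z\in\mathbb C:|z|<1\}$ and, for $0<p<\infty$, let $H^p(\mathbb D)$ be the Hardy space of all holomorphic $f:\mathbb D\to\mathbb C$ with $$\|f\|_p=\sup_{0<r<1}\left(\frac1{2\pi}\int_0^{2\pi}|f(re^{i\theta})|^p\,d\theta\right)^{1/p}<\infty,$$ equipped with the topology given by $\|\cdot\|_p$ (the norm topology if $p\ge 1$, the topology of the metric $\|f-g\|_p^p$ if $p<1$). Let $F:H^p(\mathbb D)\to\mathbb C$ be a continuous function (not assumed linear) such that (i) $F(f)\in f(\mathbb D)$ for every $f\in H^p(\mathbb D)$; (ii) $F(fg)=F(f)F(g)$ whenever $f,g\in H^p(\mathbb D)$ and the pointwise product $fg$ belongs to $H^p(\mathbb D)$. Then there exists a point $w\in\mathbb D$ such that $F(f)=f(w)$ for every $f\in H^p(\mathbb D)$ that has no zero in $\mathbb D$. -/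

import Mathlib

open scoped ENNReal Complex.UnitDisc

/-- The extension by zero to `ℂ` of a function on the open unit disc. -/
noncomputable def discExt (f : 𝔻 → ℂ) : ℂ → ℂ :=
  Function.extend (fun z : 𝔻 => (z : ℂ)) f 0

/-- `f` is holomorphic on the open unit disc. -/
def IsHolomorphicOnDisc (f : 𝔻 → ℂ) : Prop :=
  DifferentiableOn ℂ (discExt f) (Metric.ball (0 : ℂ) 1)

/-- The Hardy (quasi-)norm
`‖f‖_p = sup_{0 < r < 1} ((1 / 2π) ∫_0^{2π} |f (r e^{iθ})| ^ p dθ) ^ (1 / p)`, as an extended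
nonnegative number. -/
noncomputable def hardyENorm (p : ℝ) (f : 𝔻 → ℂ) : ℝ≥0∞ :=
  ⨆ r ∈ Set.Ioo (0 : ℝ) 1,
    ((ENNReal.ofReal (2 * Real.pi))⁻¹ *
      ∫⁻ θ in Set.Ioc (0 : ℝ) (2 * Real.pi), ‖discExt f (circleMap 0 r θ)‖ₑ ^ p) ^ (1 / p)

/-- Membership in the Hardy space `H^p(𝔻)`. -/
def MemHardy (p : ℝ) (f : 𝔻 → ℂ) : Prop :=
  IsHolomorphicOnDisc f ∧ hardyENorm p f < ∞

/-- The Hardy space `H^p(𝔻)`, of interest for `0 < p < ∞`. -/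
@[ext]
structure HardySpace (p : ℝ) where
  /-- the underlying function on the open unit disc -/
  toFun : 𝔻 → ℂ
  mem : MemHardy p toFun

instance (p : ℝ) : CoeFun (HardySpace p) (fun _ => 𝔻 → ℂ) := ⟨HardySpace.toFun⟩

/-- The topology of `H^p(𝔻)` given by the Hardy (quasi-)norm: a set is open iff around each of its
points it contains a ball of positive radius. For `0 < p < 1` the balls of `‖·‖_p` are those of the
metric `‖f - g‖_p ^ p`, so this is the usual metric topology for all `0 < p < ∞`. -/
instance (p : ℝ) : TopologicalSpace (HardySpace p) where
  IsOpen U := ∀ f ∈ U, ∃ ε : ℝ≥0∞, 0 < ε ∧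
    ∀ g : HardySpace p, hardyENorm p (fun z => g z - f z) < ε → g ∈ U
  isOpen_univ := fun _ _ => ⟨1, one_pos, fun _ _ => Set.mem_univ _⟩
  isOpen_inter := by
    intro U V hU hV f hf
    obtain ⟨a, ha, hUa⟩ := hU f hf.1
    obtain ⟨b, hb, hVb⟩ := hV f hf.2
    exact ⟨min a b, lt_min ha hb, fun g hg =>
      ⟨hUa g (hg.trans_le (min_le_left a b)), hVb g (hg.trans_le (min_le_right a b))⟩⟩
  isOpen_sUnion := by
    intro S hS f hf
    obtain ⟨U, hU, hfU⟩ := hf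
    obtain ⟨a, ha, h⟩ := hS U hU f hfU
    exact ⟨a, ha, fun g hg => ⟨U, hU, h g hg⟩⟩

/-! ### Characters of commutative Banach algebras from multiplicative functions. -/

section BanachAlgebra

/-! On the Banach algebra `hInfty` of bounded holomorphic functions, F is multiplicative and F(a) is
a value of a. Hence F(exp a) = exp(a(z)) for some z, and for ‖a‖ < π the principal logarithm of
F(exp a) is itself a value of a. This logarithm is additive near 0 and extends by scaling to an
additive ψ whose value at each a is a value of a. So ψ is norm-decreasing, fixes scalars and is
nonzero on units; a real-linear Gleason–Kahane–Żelazko argument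
(`AddMonoidHom.exists_algHom_of_isUnit_ne_zero`) makes it a character χ.

The point w is χ of the coordinate function, a value of that function and so in the disc. Dividing K
- K(w) by z - w gives χ(K) = K(w) for K holomorphic on a larger disc (`hInfty.exists_eval`), so
F(exp K) = exp(K(w)).

A zero-free f = exp k equals h^n with h = exp(k/n) in H^{np}. The dilates of h are exponentials of
functions holomorphic on larger discs, so F takes them to h(ρw). Choosing n with np ≥ 2 and np > p
makes the dilates converge to h in H^p by an argument on Taylor coefficients, without boundary
values (`tendsto_hardyENorm_dilate_sub`). Continuity gives F(h) = h(w), and multiplicativity gives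
F(f) = h(w)^n = f(w). -/

theorem NormedSpace.norm_exp_le_exp_norm {A : Type*} [NormedCommRing A] [NormedAlgebra ℂ A]
    [NormOneClass A] (x : A) : ‖NormedSpace.exp x‖ ≤ Real.exp ‖x‖ := by
  rw [NormedSpace.exp_eq_tsum ℂ, Real.exp_eq_exp_ℝ, NormedSpace.exp_eq_tsum ℝ]
  refine tsum_of_norm_bounded (NormedSpace.expSeries_summable' (𝕂 := ℝ) ‖x‖).hasSum fun n => ?_
  rw [norm_smul, smul_eq_mul]
  simp only [norm_inv, Complex.norm_natCast]
  gcongr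
  exact norm_pow_le x n

/-- A nowhere vanishing entire function has an entire logarithm. -/
theorem Complex.exists_eq_exp_of_differentiable {E : ℂ → ℂ} (hE : Differentiable ℂ E) (h0 : ∀ z, E z ≠ 0)
    (h1 : E 0 = 1) :
    ∃ g : ℂ → ℂ, Differentiable ℂ g ∧ g 0 = 0 ∧ ∀ z, E z = Complex.exp (g z) := by
  have hd : Differentiable ℂ (fun z => deriv E z / E z) :=
    (hE.contDiff.differentiable_deriv_two).fun_div hE h0
  obtain ⟨g, hg0, hg⟩ := hd.isExactOn_univ.with_val_at 0 0
  have hg' : ∀ z, HasDerivAt g (deriv E z / E z) z := fun z => hg z trivial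
  refine ⟨g, fun z => (hg' z).differentiableAt, hg0, fun z => ?_⟩
  have hc : ∀ z, HasDerivAt (fun z => E z * Complex.exp (-g z)) 0 z := fun z => by
    have := (hE z).hasDerivAt.mul ((hg' z).neg.cexp)
    refine this.congr_deriv ?_
    field_simp [h0 z]
    ring
  have := is_const_of_deriv_eq_zero (fun z => (hc z).differentiableAt) (fun z => (hc z).deriv) z 0
  simp only [hg0, h1, neg_zero, Complex.exp_zero, mul_one, Complex.exp_neg] at this
  field_simp at this
  exact this

/-- An entire function vanishing at the origin whose real part grows at most linearly is linear. -/
theorem Complex.eq_mul_of_re_le {g : ℂ → ℂ} (hg : Differentiable ℂ g) (h0 : g 0 = 0)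
    {C : ℝ} (hC : ∀ z, (g z).re ≤ C * ‖z‖) : ∃ c, ∀ z, g z = c * z := by
  have hC0 : 0 ≤ C := by
    -- A negative `C` would make exp ∘ g bounded, hence constant of modulus 1, against the strict
    -- bound at 1.
    by_contra! h
    have hbd : ∀ z, ‖Complex.exp (g z)‖ ≤ 1 := fun z => by
      rw [Complex.norm_exp]
      exact Real.exp_le_one_iff.2 ((hC z).trans (mul_nonpos_of_nonpos_of_nonneg h.le (norm_nonneg _)))
    have := hg.cexp.apply_eq_apply_of_bounded
      ((Metric.isBounded_iff_subset_closedBall 0).2 ⟨1, by rintro _ ⟨z, rfl⟩; simpa using hbd z⟩) 1 0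
    have h2 : ‖Complex.exp (g 1)‖ = 1 := by rw [this, h0]; simp
    rw [Complex.norm_exp, Real.exp_eq_one_iff] at h2
    have := hC 1
    simp at this
    linarith
  -- Borel–Carathéodory on the disc of radius 2(‖z‖ + 1); `C + 1` replaces `C` to keep the bound
  -- positive. Growth is then linear, so Cauchy's estimate bounds g' and Liouville makes it
  -- constant.
  have hb : ∀ z, ‖g z‖ ≤ 2 * (2 * (C + 1) * (‖z‖ + 1)) := fun z => by
    have := Complex.borelCaratheodory_zero (f := g) (R := 2 * (‖z‖ + 1))
      (M := 2 * (C + 1) * (‖z‖ + 1)) (z := z) (by positivity) hg.differentiableOn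
      (fun w hw => ?_) (by positivity) (by simp; linarith [norm_nonneg z]) h0
    · refine this.trans ?_
      rw [div_le_iff₀ (by linarith [norm_nonneg z])]
      have : 0 ≤ 2 * (2 * (C + 1) * (‖z‖ + 1)) := by positivity
      nlinarith [norm_nonneg z]
    · have hw' : ‖w‖ < 2 * (‖z‖ + 1) := by simpa using hw
      refine (hC w).trans ?_
      nlinarith [norm_nonneg z]
  have hd : ∀ z, ‖deriv g z‖ ≤ 8 * (C + 1) := fun z => by
    have hz := norm_nonneg z
    have := Complex.norm_deriv_le_of_forall_mem_sphere_norm_le (f := g) (c := z) (R := ‖z‖ + 1)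
      (C := 8 * (C + 1) * (‖z‖ + 1)) (by positivity) hg.diffContOnCl (fun w hw => ?_)
    · rwa [mul_div_cancel_right₀ _ (by positivity)] at this
    · refine (hb w).trans ?_
      have : ‖w‖ ≤ 2 * ‖z‖ + 1 := by
        have h1 : ‖w - z‖ = ‖z‖ + 1 := by simpa [dist_eq_norm] using hw
        have := norm_add_le (w - z) z
        rw [sub_add_cancel] at this
        linarith
      nlinarith
  have hcst := (hg.contDiff.differentiable_deriv_two).apply_eq_apply_of_bounded
    ((Metric.isBounded_iff_subset_closedBall 0).2
      ⟨8 * (C + 1), by rintro _ ⟨z, rfl⟩; simpa using hd z⟩)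
  refine ⟨deriv g 0, fun z => ?_⟩
  have hc : ∀ z, HasDerivAt (fun z => g z - deriv g 0 * z) 0 z := fun z => by
    have := (hg z).hasDerivAt.sub ((hasDerivAt_id z).const_mul (deriv g 0))
    refine this.congr_deriv ?_
    rw [hcst z 0]; simp
  have := is_const_of_deriv_eq_zero (fun z => (hc z).differentiableAt) (fun z => (hc z).deriv) z 0
  simp only [h0, mul_zero, sub_zero] at this
  linear_combination this

variable {A : Type*} [NormedCommRing A] [NormedAlgebra ℂ A] [CompleteSpace A]

/-- The free factor `b` allows iteration: b = 1 and b = f give the first two derivatives of t ↦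
L(exp(tf)). -/
theorem HasDerivAt.clm_exp_smul (L : A →L[ℂ] ℂ) (b f : A) (t : ℂ) :
    HasDerivAt (fun t : ℂ => L (b * NormedSpace.exp (t • f)))
      (L (b * f * NormedSpace.exp (t • f))) t := by
  have := L.hasFDerivAt.comp_hasDerivAt t ((hasDerivAt_exp_smul_const' f t).const_mul b)
  simpa [Function.comp_def, mul_assoc] using this

/-- The multiplicative step of the Gleason–Kahane–Żelazko theorem. -/
theorem ContinuousLinearMap.map_mul_of_exp_ne_zero [NormOneClass A] (L : A →L[ℂ] ℂ) (h1 : L 1 = 1)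
    (hL : ∀ a, L (NormedSpace.exp a) ≠ 0) (hb : ∀ a, ‖L a‖ ≤ ‖a‖) (a b : A) :
    L (a * b) = L a * L b := by
  -- The entire function L(exp(tf)) is zero-free of exponential type with value 1 at 0, so it is
  -- e^{ct}. Its first two derivatives at 0 give L(f) = c and L(f²) = c²; polarization then gives
  -- products.
  have sq : ∀ f, L (f * f) = L f * L f := fun f => by
    have hE : ∀ b t, HasDerivAt (fun t : ℂ => L (b * NormedSpace.exp (t • f)))
      (L (b * f * NormedSpace.exp (t • f))) t := fun b t => .clm_exp_smul L b f t
    have hE1 := hE 1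
    simp only [one_mul] at hE1
    obtain ⟨g, hg, hg0, hgE⟩ := Complex.exists_eq_exp_of_differentiable
      (E := fun t : ℂ => L (NormedSpace.exp (t • f))) (fun t => (hE1 t).differentiableAt)
      (fun t => hL _) (by simpa using h1)
    obtain ⟨c, hc⟩ := Complex.eq_mul_of_re_le hg (C := ‖f‖) hg0 (fun z => by
      rw [← Real.exp_le_exp, ← Complex.norm_exp, ← hgE]
      refine (hb _).trans ((NormedSpace.norm_exp_le_exp_norm _).trans ?_)
      rw [norm_smul, mul_comm])
    have e0 : (fun t : ℂ => L (NormedSpace.exp (t • f))) = fun t => Complex.exp (c * t) := by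
      ext t; rw [hgE, hc]
    have hx : ∀ t, HasDerivAt (fun t => Complex.exp (c * t)) (Complex.exp (c * t) * c) t :=
      fun t => by simpa using ((hasDerivAt_id t).const_mul c).cexp
    have e1 : (fun t : ℂ => L (f * NormedSpace.exp (t • f))) = fun t => Complex.exp (c * t) * c := by
      ext t
      have := hE1 t
      rw [e0] at this
      exact this.unique (hx t)
    have e2 := hE f 0
    rw [e1] at e2
    have e3 := e2.unique ((hx 0).mul_const c)
    have e4 := congrFun e1 0
    simp only [zero_smul, NormedSpace.exp_zero, mul_one, mul_zero, Complex.exp_zero, one_mul]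
      at e3 e4
    rw [e3, e4]
  have h := sq (a + b)
  simp only [add_mul, mul_add, map_add, sq a, sq b, mul_comm b a] at h
  linear_combination h / 2

/-- Real-linear version of the Kowalski–Słodkowski theorem: an additive, norm-decreasing
functional on a commutative complex Banach algebra that fixes scalars and does not vanish on
units is a character. -/
theorem AddMonoidHom.exists_algHom_of_isUnit_ne_zero [NormOneClass A] (ψ : A →+ ℂ)
    (hb : ∀ a, ‖ψ a‖ ≤ ‖a‖) (hs : ∀ c : ℂ, ψ (c • (1 : A)) = c)
    (hu : ∀ a, IsUnit a → ψ a ≠ 0) : ∃ χ : A →ₐ[ℂ] ℂ, ∀ a, χ a = ψ a := by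
  have hcont : Continuous ψ := AddMonoidHomClass.continuous_of_bound ψ 1 (by simpa using hb)
  have hr : ∀ (r : ℝ) a, ψ ((r : ℂ) • a) = r * ψ a := fun r a => by
    have := map_real_smul ψ hcont r a
    simpa using this
  have hcs : ∀ (c : ℂ) a, ψ (c • a) = c.re * ψ a + c.im * ψ (Complex.I • a) := fun c a => by
    conv_lhs => rw [← Complex.re_add_im c]
    rw [add_smul, map_add, hr, mul_smul, hr]
  have hI : ∀ a, ψ (Complex.I • Complex.I • a) = - ψ a := fun a => by
    rw [smul_smul, Complex.I_mul_I, neg_one_smul, map_neg]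
  have hIc : Continuous fun a : A => ψ (Complex.I • a) := hcont.comp (continuous_const_smul _)
  -- `L` is the complex-linear part of ψ, and `M` below is the conjugate of its antilinear part.
  let L : A →L[ℂ] ℂ :=
    { toFun := fun a => (ψ a - Complex.I * ψ (Complex.I • a)) / 2
      map_add' := fun a b => by simp only [map_add, smul_add]; ring
      map_smul' := fun c a => by
        rw [smul_comm Complex.I c, hcs c a, hcs c (Complex.I • a), hI]
        simp only [RingHom.id_apply, smul_eq_mul]
        linear_combination (c.im * ψ (Complex.I • a) / 2) * Complex.I_mul_I +
          ((ψ a - Complex.I * ψ (Complex.I • a)) / 2) * Complex.re_add_im c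
      cont := by fun_prop }
  let M : A →L[ℂ] ℂ :=
    { toFun := fun a => (starRingEnd ℂ) ((ψ a + Complex.I * ψ (Complex.I • a)) / 2)
      map_add' := fun a b => by rw [← map_add]; congr 1; simp only [map_add, smul_add]; ring
      map_smul' := fun c a => by
        rw [smul_comm Complex.I c, hcs c a, hcs c (Complex.I • a), hI]
        simp only [RingHom.id_apply, smul_eq_mul]
        apply (starRingEnd ℂ).injective
        rw [map_mul]
        simp only [Complex.conj_conj]
        have hc : (starRingEnd ℂ) c = c.re - c.im * Complex.I := by apply Complex.ext <;> simp
        rw [hc]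
        linear_combination (c.im * ψ (Complex.I • a) / 2) * Complex.I_mul_I
      cont := by
        refine Complex.continuous_conj.comp ?_
        fun_prop }
  have hψ : ∀ a, ψ a = L a + (starRingEnd ℂ) (M a) := fun a => by
    change _ = (ψ a - Complex.I * ψ (Complex.I • a)) / 2
      + (starRingEnd ℂ) ((starRingEnd ℂ) ((ψ a + Complex.I * ψ (Complex.I • a)) / 2))
    rw [Complex.conj_conj]; ring
  -- If the moduli agreed, a rotation u with u² = -conj(M a)/L a would give ψ(u a) = 0 at a unit.
  have hne : ∀ a, IsUnit a → ‖L a‖ ≠ ‖M a‖ := fun a ha h => by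
    obtain ⟨u, hu1, hu2⟩ : ∃ u : ℂ, ‖u‖ = 1 ∧
        u * L a + (starRingEnd ℂ) (u * M a) = 0 := by
      rcases eq_or_ne (L a) 0 with h0 | h0
      · rw [h0, norm_zero] at h
        exact ⟨1, by simp, by rw [h0, norm_eq_zero.1 h.symm]; simp⟩
      · obtain ⟨u, hu⟩ := IsAlgClosed.exists_pow_nat_eq (-(starRingEnd ℂ) (M a) / L a) two_pos
        have hn : ‖u‖ = 1 := by
          have := congrArg norm hu
          rw [norm_pow, norm_div, norm_neg, RCLike.norm_conj, ← h,
            div_self (norm_ne_zero_iff.2 h0)] at this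
          exact (pow_eq_one_iff_of_nonneg (norm_nonneg _) two_ne_zero).1 this
        refine ⟨u, hn, ?_⟩
        have hconj : (starRingEnd ℂ) u * u = 1 := by
          rw [mul_comm, Complex.mul_conj, Complex.normSq_eq_norm_sq, hn]; simp
        field_simp at hu
        rw [map_mul]
        linear_combination (starRingEnd ℂ) u * hu - u * L a * hconj
    have hu0 : u ≠ 0 := norm_ne_zero_iff.1 (by rw [hu1]; exact one_ne_zero)
    refine hu (u • a) ?_ ?_
    · rw [Algebra.smul_def]
      exact (hu0.isUnit.map (algebraMap ℂ A)).mul ha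
    · rw [hψ, map_smul, map_smul, smul_eq_mul, smul_eq_mul, hu2]
  have hL1 : L 1 = 1 := by
    change (ψ 1 - Complex.I * ψ (Complex.I • 1)) / 2 = 1
    have := hs 1
    rw [one_smul] at this
    rw [hs, this, Complex.I_mul_I]; norm_num
  have hM1 : M 1 = 0 := by
    have := hψ 1
    rw [hL1, ← one_smul ℂ (1 : A), hs, one_smul] at this
    simpa using this
  have hexp : ∀ a : A, IsUnit (NormedSpace.exp a) := fun a => by
    let : NormedAlgebra ℚ A := NormedAlgebra.restrictScalars ℚ ℂ A
    exact NormedSpace.isUnit_exp a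
  -- Along t ↦ exp(ta) the difference |L| - |M| starts at 1 and never vanishes, so it stays
  -- positive.
  have hlt : ∀ a, ‖M (NormedSpace.exp a)‖ < ‖L (NormedSpace.exp a)‖ := fun a => by
    by_contra! h
    have hc : Continuous fun t : ℝ => NormedSpace.exp ((t : ℂ) • a) :=
      ((differentiable_exp_smul_const ℂ a).continuous).comp Complex.continuous_ofReal
    have hu : Continuous fun t : ℝ =>
        ‖L (NormedSpace.exp ((t : ℂ) • a))‖ - ‖M (NormedSpace.exp ((t : ℂ) • a))‖ :=
      (L.continuous.comp hc).norm.sub (M.continuous.comp hc).norm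
    obtain ⟨t, -, ht⟩ := intermediate_value_Icc' (zero_le_one' ℝ) hu.continuousOn
      (show (0 : ℝ) ∈ Set.Icc _ _ by simpa [hL1, hM1] using h)
    exact hne _ (hexp _) (sub_eq_zero.1 ht)
  -- M/L along exp(ta) is entire, bounded by 1 and zero at t = 0, hence zero by Liouville;
  -- differentiating M(exp(ta)) at 0 gives M a = 0.
  have hM0 : ∀ a, M a = 0 := fun a => by
    have hl := fun t => HasDerivAt.clm_exp_smul L 1 a t
    have hm := fun t => HasDerivAt.clm_exp_smul M 1 a t
    simp only [one_mul] at hl hm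
    have hL0 : ∀ t : ℂ, L (NormedSpace.exp (t • a)) ≠ 0 := fun t h => by
      have := hlt (t • a)
      rw [h, norm_zero] at this
      exact this.not_ge (norm_nonneg _)
    have hq : Differentiable ℂ
        fun t : ℂ => M (NormedSpace.exp (t • a)) / L (NormedSpace.exp (t • a)) :=
      fun t => (hm t).differentiableAt.fun_div (hl t).differentiableAt (hL0 t)
    have hz : ∀ t : ℂ, M (NormedSpace.exp (t • a)) = 0 := fun t => by
      have := hq.apply_eq_apply_of_bounded ((Metric.isBounded_iff_subset_closedBall 0).2
        ⟨1, by
          rintro _ ⟨z, rfl⟩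
          rw [mem_closedBall_zero_iff, norm_div]
          exact div_le_one_of_le₀ (hlt _).le (norm_nonneg _)⟩) t 0
      simpa [hM1, hL0 t] using this
    have := hm 0
    simp only [hz] at this
    simpa using this.unique (hasDerivAt_const (0 : ℂ) (0 : ℂ))
  have hLψ : ∀ a, L a = ψ a := fun a => by rw [hψ, hM0]; simp
  have hmul := L.map_mul_of_exp_ne_zero hL1 (fun a => by rw [hLψ]; exact hu _ (hexp a))
    (fun a => by rw [hLψ]; exact hb a)
  exact ⟨AlgHom.ofLinearMap L.toLinearMap hL1 hmul, hLψ⟩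

theorem AlgHom.map_exp_of_norm_le (χ : A →ₐ[ℂ] ℂ) (hχ : ∀ a, ‖χ a‖ ≤ ‖a‖) (a : A) :
    χ (NormedSpace.exp a) = Complex.exp (χ a) := by
  let : NormedAlgebra ℚ A := NormedAlgebra.restrictScalars ℚ ℂ A
  rw [NormedSpace.map_exp χ (AddMonoidHomClass.continuous_of_bound χ 1 (by simpa using hχ)),
    Complex.exp_eq_exp_ℂ]

/-- A multiplicative function on a commutative Banach algebra whose value at each `a` is attained
by one of the characters `ev z` agrees on exponentials with a character. -/
theorem exists_algHom_of_mul_of_mem_range [NormOneClass A] {ι : Type*} (ev : ι → A →ₐ[ℂ] ℂ)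
    (hev : ∀ z a, ‖ev z a‖ ≤ ‖a‖) (Φ : A → ℂ) (hmul : ∀ a b, Φ (a * b) = Φ a * Φ b)
    (hrange : ∀ a, ∃ z, Φ a = ev z a) :
    ∃ χ : A →ₐ[ℂ] ℂ, (∀ a, ∃ z, χ a = ev z a) ∧
      ∀ a, Φ (NormedSpace.exp a) = Complex.exp (χ a) := by
  let : NormedAlgebra ℚ A := NormedAlgebra.restrictScalars ℚ ℂ A
  have he : ∀ z a, ev z (NormedSpace.exp a) = Complex.exp (ev z a) := fun z a =>
    AlgHom.map_exp_of_norm_le (ev z) (hev z) a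
  set l : A → ℂ := fun a => Complex.log (Φ (NormedSpace.exp a)) with hl
  have him : ∀ (c : ℂ), ‖c‖ < Real.pi → Complex.log (Complex.exp c) = c := fun c hc =>
    Complex.log_exp (abs_lt.1 ((Complex.abs_im_le_norm c).trans_lt hc)).1
      (abs_lt.1 ((Complex.abs_im_le_norm c).trans_lt hc)).2.le
  have hlz : ∀ a : A, ‖a‖ < Real.pi → ∃ z, l a = ev z a := fun a ha => by
    obtain ⟨z, hz⟩ := hrange (NormedSpace.exp a)
    refine ⟨z, ?_⟩
    rw [hl]
    simp only
    rw [hz, he, him _ ((hev z a).trans_lt ha)]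
  have hle : ∀ a : A, Complex.exp (l a) = Φ (NormedSpace.exp a) := fun a => by
    refine Complex.exp_log ?_
    obtain ⟨z, hz⟩ := hrange (NormedSpace.exp a)
    rw [hz, he]
    exact Complex.exp_ne_zero _
  have hln : ∀ a : A, ‖a‖ < Real.pi → ‖l a‖ ≤ ‖a‖ := fun a ha => by
    obtain ⟨z, hz⟩ := hlz a ha
    rw [hz]; exact hev z a
  have hladd : ∀ a b : A, ‖a‖ + ‖b‖ < Real.pi → l (a + b) = l a + l b := fun a b hab => by
    have ha : ‖a‖ < Real.pi := by linarith [norm_nonneg b]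
    have hb : ‖b‖ < Real.pi := by linarith [norm_nonneg a]
    rw [← him (l a + l b) (by linarith [norm_add_le (l a) (l b), hln a ha, hln b hb]),
      Complex.exp_add, hle, hle, ← hmul, ← NormedSpace.exp_add]
  have hlnsmul : ∀ (n : ℕ) (a : A), n * ‖a‖ < Real.pi → l ((n : ℂ) • a) = n * l a := by
    intro n a hna
    induction n with
    | zero =>
      have := hln 0 (by simpa using Real.pi_pos)
      simpa using this
    | succ n ih =>
      push_cast at hna
      push_cast
      have hn : (n : ℝ) * ‖a‖ < Real.pi := by linarith [norm_nonneg a]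
      rw [add_smul, one_smul, hladd, ih hn, add_mul, one_mul]
      rw [norm_smul, Complex.norm_natCast]
      linarith
  -- Dividing by ⌊‖a‖⌋ + 1 > ‖a‖ brings a into the unit ball, where l is additive. Any larger
  -- natural number gives the same value, by passing to a common multiple.
  set ψ : A → ℂ := fun a => (⌊‖a‖⌋₊ + 1 : ℕ) * l (((⌊‖a‖⌋₊ + 1 : ℕ) : ℂ)⁻¹ • a) with hψd
  have hsmall : ∀ (n : ℕ) (a : A), ‖a‖ < n → ‖((n : ℂ)⁻¹) • a‖ < 1 := fun n a h => by
    rw [norm_smul, norm_inv, Complex.norm_natCast, inv_mul_lt_iff₀ ((norm_nonneg a).trans_lt h)]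
    simpa using h
  have hsplit : ∀ (n m : ℕ) (a : A), ‖a‖ < n → ‖a‖ < m →
      n * l ((n : ℂ)⁻¹ • a) = (n * m) * l (((n : ℂ) * m)⁻¹ • a) := fun n m a hn hm => by
    have hn0 : (0 : ℝ) < n := (norm_nonneg a).trans_lt hn
    have hm0 : (0 : ℝ) < m := (norm_nonneg a).trans_lt hm
    have hn0' : (n : ℂ) ≠ 0 := by exact_mod_cast hn0.ne'
    have hm0' : (m : ℂ) ≠ 0 := by exact_mod_cast hm0.ne'
    rw [mul_assoc, ← hlnsmul m, smul_smul]
    · congr 3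
      field_simp
    · have : (m : ℝ) * ‖((n : ℂ) * m)⁻¹ • a‖ = ‖((n : ℂ)⁻¹) • a‖ := by
        rw [norm_smul, norm_smul, norm_inv, norm_inv, norm_mul, Complex.norm_natCast,
          Complex.norm_natCast]
        field_simp
      rw [this]
      linarith [hsmall n a hn, Real.pi_gt_three]
  have hψ : ∀ (n : ℕ) (a : A), ‖a‖ < n → ψ a = n * l ((n : ℂ)⁻¹ • a) := fun n a hn => by
    have hm : ‖a‖ < (⌊‖a‖⌋₊ + 1 : ℕ) := by push_cast; exact Nat.lt_floor_add_one _
    rw [hψd]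
    simp only
    rw [hsplit _ n a hm hn, hsplit n _ a hn hm, mul_comm (n : ℂ)]
  have hbig : ∀ x : ℝ, ∃ n : ℕ, x < n := exists_nat_gt
  have hψz : ∀ a, ∃ z, ψ a = ev z a := fun a => by
    obtain ⟨n, hn⟩ := hbig ‖a‖
    have hn0 : (0 : ℝ) < n := (norm_nonneg a).trans_lt hn
    have hn0' : (n : ℂ) ≠ 0 := by exact_mod_cast hn0.ne'
    obtain ⟨z, hz⟩ := hlz ((n : ℂ)⁻¹ • a) (by linarith [hsmall n a hn, Real.pi_gt_three])
    refine ⟨z, ?_⟩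
    rw [hψ n a hn, hz, map_smul, smul_eq_mul, mul_inv_cancel_left₀ hn0']
  have hψadd : ∀ a b, ψ (a + b) = ψ a + ψ b := fun a b => by
    obtain ⟨n, hn⟩ := hbig (‖a‖ + ‖b‖)
    have ha : ‖a‖ < n := by linarith [norm_nonneg b]
    have hb : ‖b‖ < n := by linarith [norm_nonneg a]
    rw [hψ n a ha, hψ n b hb, hψ n _ ((norm_add_le a b).trans_lt hn), smul_add, hladd, mul_add]
    linarith [hsmall n a ha, hsmall n b hb, Real.pi_gt_three]
  have hψe : ∀ a, Φ (NormedSpace.exp a) = Complex.exp (ψ a) := fun a => by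
    obtain ⟨n, hn⟩ := hbig ‖a‖
    have hn0 : (0 : ℝ) < n := (norm_nonneg a).trans_lt hn
    have hn0' : (n : ℂ) ≠ 0 := by exact_mod_cast hn0.ne'
    have hpow : ∀ (k : ℕ) (b : A), 0 < k →
        Φ (NormedSpace.exp ((k : ℂ) • b)) = Φ (NormedSpace.exp b) ^ k := fun k b hk => by
      induction k, hk using Nat.le_induction with
      | base => simp
      | succ k _ ih =>
        push_cast
        rw [add_smul, one_smul, NormedSpace.exp_add, hmul, ih, pow_succ]
    rw [hψ n a hn, Complex.exp_nat_mul, hle, ← hpow n _ (by exact_mod_cast hn0), smul_smul,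
      mul_inv_cancel₀ hn0', one_smul]
  -- All three hypotheses follow from ψ(a) being `ev z a` for some z depending on a.
  obtain ⟨χ, hχ⟩ := AddMonoidHom.exists_algHom_of_isUnit_ne_zero (AddMonoidHom.mk' ψ hψadd)
    (fun a => by
      obtain ⟨z, hz⟩ := hψz a
      rw [AddMonoidHom.mk'_apply, hz]; exact hev z a)
    (fun c => by
      obtain ⟨z, hz⟩ := hψz (c • 1)
      rw [AddMonoidHom.mk'_apply, hz, map_smul, smul_eq_mul, map_one, mul_one])
    (fun a ha => by
      obtain ⟨z, hz⟩ := hψz a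
      rw [AddMonoidHom.mk'_apply, hz]
      exact (ha.map (ev z)).ne_zero)
  simp only [AddMonoidHom.mk'_apply] at hχ
  exact ⟨χ, fun a => by rw [hχ]; exact hψz a, fun a => by rw [hχ]; exact hψe a⟩

end BanachAlgebra

/-! ### Holomorphic functions on the disc and their circle means. -/

section Holomorphic

@[simp]
theorem discExt_coe (f : 𝔻 → ℂ) (z : 𝔻) : discExt f z = f z :=
  Complex.UnitDisc.coe_injective.extend_apply f 0 z

theorem eqOn_discExt {f : 𝔻 → ℂ} {g : ℂ → ℂ} (h : ∀ z : 𝔻, f z = g z) :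
    Set.EqOn (discExt f) g (Metric.ball 0 1) := fun z hz => by
  lift z to 𝔻 using by simpa using hz
  rw [discExt_coe, h]

theorem IsHolomorphicOnDisc.of_eq {f : 𝔻 → ℂ} {g : ℂ → ℂ}
    (hg : DifferentiableOn ℂ g (Metric.ball 0 1)) (h : ∀ z : 𝔻, f z = g z) :
    IsHolomorphicOnDisc f :=
  hg.congr (eqOn_discExt h)

theorem IsHolomorphicOnDisc.continuous {f : 𝔻 → ℂ} (hf : IsHolomorphicOnDisc f) :
    Continuous f := by
  have : f = fun z : 𝔻 => discExt f z := by ext; simp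
  rw [this]
  exact hf.continuousOn.comp_continuous Complex.UnitDisc.continuous_coe
    fun z => by simpa using z.norm_lt_one

/-- The `p`-th power mean of `|f|` over the circle of radius `r`. -/
noncomputable def circleMean (p r : ℝ) (f : 𝔻 → ℂ) : ℝ≥0∞ :=
  (ENNReal.ofReal (2 * Real.pi))⁻¹ *
    ∫⁻ θ in Set.Ioc (0 : ℝ) (2 * Real.pi), ‖discExt f (circleMap 0 r θ)‖ₑ ^ p

theorem hardyENorm_le {p : ℝ} (hp : 0 < p) {f : 𝔻 → ℂ} {a : ℝ≥0∞}
    (h : ∀ r ∈ Set.Ioo (0 : ℝ) 1, circleMean p r f ≤ a) : hardyENorm p f ≤ a ^ (1 / p) :=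
  iSup₂_le fun r hr => ENNReal.rpow_le_rpow (h r hr) (by positivity)

theorem circleMean_le {p : ℝ} (hp : 0 < p) (f : 𝔻 → ℂ) {r : ℝ} (hr : r ∈ Set.Ioo (0 : ℝ) 1) :
    circleMean p r f ≤ hardyENorm p f ^ p := by
  have h : circleMean p r f ^ (1 / p) ≤ hardyENorm p f :=
    le_iSup₂ (f := fun r (_ : r ∈ Set.Ioo (0 : ℝ) 1) => circleMean p r f ^ (1 / p)) r hr
  have := ENNReal.rpow_le_rpow h hp.le
  rwa [← ENNReal.rpow_mul, one_div_mul_cancel hp.ne', ENNReal.rpow_one] at this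

theorem circleMap_mem_unitBall {r : ℝ} (hr : r ∈ Set.Ioo (0 : ℝ) 1) (θ : ℝ) :
    circleMap 0 r θ ∈ Metric.ball (0 : ℂ) 1 := by
  simp [abs_of_pos hr.1, hr.2]

theorem circleMean_const_le {p r : ℝ} (f : 𝔻 → ℂ) {c : ℝ≥0∞}
    (h : ∀ θ, ‖discExt f (circleMap 0 r θ)‖ₑ ^ p ≤ c) : circleMean p r f ≤ c := by
  have hpi : ENNReal.ofReal (2 * Real.pi) ≠ 0 := by simp [Real.pi_pos]
  calc circleMean p r f ≤ (ENNReal.ofReal (2 * Real.pi))⁻¹ *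
        ∫⁻ θ in Set.Ioc (0 : ℝ) (2 * Real.pi), c := by
        unfold circleMean; gcongr with θ; exact h θ
    _ = c := by
        rw [MeasureTheory.setLIntegral_const, Real.volume_Ioc, sub_zero, mul_comm c, ← mul_assoc,
          ENNReal.inv_mul_cancel hpi ENNReal.ofReal_ne_top, one_mul]

theorem MemHardy.of_bounded {p : ℝ} (hp : 0 < p) {f : 𝔻 → ℂ} (hf : IsHolomorphicOnDisc f) {C : ℝ}
    (hC : ∀ z, ‖f z‖ ≤ C) : MemHardy p f := by
  refine ⟨hf, (hardyENorm_le hp (a := ENNReal.ofReal C ^ p) fun r hr =>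
    circleMean_const_le f fun θ => ?_).trans_lt ?_⟩
  · gcongr
    obtain ⟨z, hz⟩ : ∃ z : 𝔻, (z : ℂ) = circleMap 0 r θ :=
      ⟨.mk _ (by simpa using circleMap_mem_unitBall hr θ), rfl⟩
    rw [← hz, discExt_coe, ← ofReal_norm]
    exact ENNReal.ofReal_le_ofReal (hC z)
  · exact ENNReal.rpow_lt_top_of_nonneg (by positivity)
      (ENNReal.rpow_ne_top_of_nonneg hp.le ENNReal.ofReal_ne_top)

end Holomorphic

/-! ### The Banach algebra of bounded holomorphic functions. -/

section BoundedHolomorphic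

open BoundedContinuousFunction

/-- The algebra of bounded holomorphic functions on the disc. -/
noncomputable def hInfty : Subalgebra ℂ (𝔻 →ᵇ ℂ) where
  carrier := {f | IsHolomorphicOnDisc f}
  mul_mem' {f g} hf hg := .of_eq (DifferentiableOn.mul hf hg) fun z => by simp
  add_mem' {f g} hf hg := .of_eq (DifferentiableOn.add hf hg) fun z => by simp
  algebraMap_mem' c := .of_eq (differentiableOn_const c) fun z => rfl

/-- Uniform limits of holomorphic functions are holomorphic. The resulting completeness is what the
exponential series requires. -/
theorem isClosed_hInfty : IsClosed (hInfty : Set (𝔻 →ᵇ ℂ)) := by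
  refine IsSeqClosed.isClosed fun u f hu hf => ?_
  have h := tendsto_iff_tendstoUniformly.1 hf
  refine TendstoLocallyUniformlyOn.differentiableOn (F := fun n => discExt (u n))
    (φ := Filter.atTop) (TendstoUniformlyOn.tendstoLocallyUniformlyOn ?_)
    (.of_forall hu) Metric.isOpen_ball
  rw [Metric.tendstoUniformlyOn_iff]
  intro ε hε
  filter_upwards [Metric.tendstoUniformly_iff.1 h ε hε] with n hn z hz
  lift z to 𝔻 using by simpa using hz
  simpa using hn z

instance : CompleteSpace hInfty := isClosed_hInfty.completeSpace_coe

instance : Nonempty 𝔻 := ⟨0⟩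

instance : NormOneClass hInfty := ⟨norm_one (α := 𝔻 →ᵇ ℂ)⟩

/-- Evaluation of bounded holomorphic functions at a point. -/
noncomputable def hInfty.eval (z : 𝔻) : hInfty →ₐ[ℂ] ℂ where
  toFun a := a.1 z
  map_one' := rfl
  map_mul' _ _ := rfl
  map_zero' := rfl
  map_add' _ _ := rfl
  commutes' _ := rfl

theorem hInfty.norm_eval_le (z : 𝔻) (a : hInfty) : ‖hInfty.eval z a‖ ≤ ‖a‖ :=
  a.1.norm_coe_le_norm z

theorem hInfty.eval_exp (z : 𝔻) (a : hInfty) :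
    hInfty.eval z (NormedSpace.exp a) = Complex.exp (hInfty.eval z a) :=
  AlgHom.map_exp_of_norm_le (hInfty.eval z) (hInfty.norm_eval_le z) a

/-- The element of `hInfty` given by a bounded holomorphic function. -/
noncomputable def hInfty.of (f : 𝔻 → ℂ) (hf : IsHolomorphicOnDisc f) (C : ℝ) (hC : ∀ z, ‖f z‖ ≤ C) :
    hInfty :=
  ⟨BoundedContinuousFunction.ofNormedAddCommGroup f hf.continuous C hC, hf⟩

theorem hInfty.ext {a b : hInfty} (h : ∀ z, hInfty.eval z a = hInfty.eval z b) : a = b :=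
  Subtype.ext (BoundedContinuousFunction.ext h)

/-- A function holomorphic on a larger disc restricts to a bounded holomorphic function. -/
theorem hInfty.exists_restrict {K : ℂ → ℂ} {R : ℝ} (hR : 1 < R)
    (hK : DifferentiableOn ℂ K (Metric.ball 0 R)) :
    ∃ a : hInfty, ∀ z, hInfty.eval z a = K z := by
  obtain ⟨C, hC⟩ := (isCompact_closedBall (0 : ℂ) 1).exists_bound_of_continuousOn
    (hK.continuousOn.mono (Metric.closedBall_subset_ball hR))
  exact ⟨hInfty.of (fun z => K z)
    (.of_eq (hK.mono (Metric.ball_subset_ball hR.le)) fun _ => rfl) C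
    fun z => hC z (by simpa using z.norm_lt_one.le), fun z => rfl⟩

theorem hInfty.exists_algHom (Φ : hInfty → ℂ) (hmul : ∀ a b, Φ (a * b) = Φ a * Φ b)
    (hrange : ∀ a, ∃ z, Φ a = hInfty.eval z a) :
    ∃ χ : hInfty →ₐ[ℂ] ℂ, (∀ a, ∃ z, χ a = hInfty.eval z a) ∧
      ∀ a, Φ (NormedSpace.exp a) = Complex.exp (χ a) :=
  exists_algHom_of_mul_of_mem_range hInfty.eval hInfty.norm_eval_le Φ hmul hrange

/-- A character of `hInfty` sending the coordinate to a point of the disc is given on functions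
holomorphic on a larger disc by evaluation. -/
theorem hInfty.exists_eval (χ : hInfty →ₐ[ℂ] ℂ) (hχ : ∀ a, ∃ z, χ a = hInfty.eval z a) :
    ∃ w : 𝔻, ∀ (K : ℂ → ℂ) (R : ℝ) (a : hInfty), 1 < R → DifferentiableOn ℂ K (Metric.ball 0 R) →
      (∀ z, hInfty.eval z a = K z) → χ a = K w := by
  obtain ⟨i, hi⟩ := hInfty.exists_restrict (K := fun z => z) one_lt_two differentiableOn_id
  obtain ⟨w, hw⟩ := hχ i
  rw [hi] at hw
  refine ⟨w, fun K R a hR hK ha => ?_⟩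
  have hwR : (w : ℂ) ∈ Metric.ball (0 : ℂ) R := by simpa using w.norm_lt_one.trans hR
  -- The difference quotient of K at w is holomorphic on the same larger disc, so it defines a
  -- bounded factor b with K - K(w) = (z - w) b.
  obtain ⟨b, hb⟩ := hInfty.exists_restrict hR
    ((Complex.differentiableOn_dslope (Metric.isOpen_ball.mem_nhds hwR)).2 hK)
  have hab : a = algebraMap ℂ hInfty (K w) + (i - algebraMap ℂ hInfty (w : ℂ)) * b := by
    refine hInfty.ext fun z => ?_
    have hc : ∀ c, hInfty.eval z (algebraMap ℂ hInfty c) = c := fun c => rfl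
    rw [map_add, map_mul, map_sub, hc, hc, ha, hi, hb]
    have := sub_smul_dslope K (w : ℂ) z
    rw [smul_eq_mul] at this
    rw [this]; ring
  rw [hab, map_add, map_mul, map_sub, AlgHom.commutes, AlgHom.commutes, hw]
  simp

end BoundedHolomorphic

/-! ### Parseval's identity and convergence of dilations. -/

section Dilation

open MeasureTheory Filter Topology

/-- The uniform probability measure on `(0, 2π]`. -/
noncomputable def angleMeasure : Measure ℝ :=
  (ENNReal.ofReal (2 * Real.pi))⁻¹ • volume.restrict (Set.Ioc 0 (2 * Real.pi))

instance : IsProbabilityMeasure angleMeasure := ⟨by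
  have hpi : ENNReal.ofReal (2 * Real.pi) ≠ 0 := by simp [Real.pi_pos]
  rw [angleMeasure, Measure.smul_apply, Measure.restrict_apply_univ, Real.volume_Ioc, sub_zero,
    smul_eq_mul, ENNReal.inv_mul_cancel hpi ENNReal.ofReal_ne_top]⟩

theorem circleMean_eq_lintegral (p r : ℝ) (f : 𝔻 → ℂ) :
    circleMean p r f = ∫⁻ θ, ‖discExt f (circleMap 0 r θ)‖ₑ ^ p ∂angleMeasure := by
  rw [angleMeasure, lintegral_smul_measure, circleMean, smul_eq_mul]

theorem integral_angleMeasure (f : ℝ → ℝ) :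
    ∫ θ, f θ ∂angleMeasure = (2 * Real.pi)⁻¹ * ∫ θ in (0 : ℝ)..2 * Real.pi, f θ := by
  rw [angleMeasure, integral_smul_measure, intervalIntegral.integral_of_le Real.two_pi_pos.le,
    ENNReal.toReal_inv, ENNReal.toReal_ofReal Real.two_pi_pos.le, smul_eq_mul]

theorem summable_norm_sq {c : ℕ → ℂ} (hc : Summable fun n => ‖c n‖) :
    Summable fun n => ‖c n‖ ^ 2 := by
  refine Summable.of_norm_bounded_eventually_nat hc ?_
  filter_upwards [hc.tendsto_atTop_zero.eventually_le_const one_pos] with n hn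
  rw [norm_pow, norm_norm, sq]
  exact mul_le_of_le_one_left (norm_nonneg _) hn

/-- Parseval's identity for absolutely convergent power series on the unit circle. -/
theorem integral_norm_sq_of_hasSum {c : ℕ → ℂ} (hc : Summable fun n => ‖c n‖) {g : ℝ → ℂ}
    (hg : ∀ θ, HasSum (fun n => c n * circleMap 0 1 θ ^ n) (g θ)) :
    ∫ θ, ‖g θ‖ ^ 2 ∂angleMeasure = ∑' n, ‖c n‖ ^ 2 := by
  have hc2 := summable_norm_sq hc
  set P : ℕ → Polynomial ℂ := fun N => ∑ n ∈ Finset.range N, Polynomial.monomial n (c n) with hP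
  have hcoeff : ∀ N i, (P N).coeff i = if i < N then c i else 0 := fun N i => by
    simp [hP, Polynomial.coeff_monomial]
  have heval : ∀ N z, (P N).eval z = ∑ n ∈ Finset.range N, c n * z ^ n := fun N z => by
    simp [hP, Polynomial.eval_finsetSum]
  have hpars : ∀ N, ∫ θ, ‖(P N).eval (circleMap 0 1 θ)‖ ^ 2 ∂angleMeasure =
      ∑ n ∈ Finset.range N, ‖c n‖ ^ 2 := fun N => by
    rw [integral_angleMeasure]
    have h := (P N).sum_sq_norm_coeff_eq_circleAverage
    rw [Real.circleAverage, smul_eq_mul] at h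
    rw [← h]
    rw [Finset.sum_subset (s₂ := Finset.range N)]
    · exact Finset.sum_congr rfl fun i hi => by rw [hcoeff, if_pos (Finset.mem_range.1 hi)]
    · intro i hi
      by_contra h
      rw [Polynomial.mem_support_iff, hcoeff, if_neg (by simpa using h)] at hi
      exact hi rfl
    · intro i _ hi
      rw [Polynomial.notMem_support_iff.1 hi]; simp
  have hlim : Tendsto (fun N => ∫ θ, ‖(P N).eval (circleMap 0 1 θ)‖ ^ 2 ∂angleMeasure) atTop
      (𝓝 (∫ θ, ‖g θ‖ ^ 2 ∂angleMeasure)) := by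
    refine tendsto_integral_of_dominated_convergence (fun _ => (∑' n, ‖c n‖) ^ 2) (fun N => ?_)
      (integrable_const _) (fun N => .of_forall fun θ => ?_) (.of_forall fun θ => ?_)
    · exact Continuous.aestronglyMeasurable
        (((P N).continuous.comp (continuous_circleMap 0 1)).norm.pow 2)
    · rw [norm_pow, norm_norm, heval]
      gcongr
      refine (norm_sum_le _ _).trans (le_trans (Finset.sum_le_sum fun i _ => ?_)
        (hc.sum_le_tsum (Finset.range N) fun _ _ => norm_nonneg _))
      simp
    · simp_rw [heval]
      exact ((hg θ).tendsto_sum_nat).norm.pow 2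
  simp_rw [hpars] at hlim
  exact tendsto_nhds_unique hlim hc2.hasSum.tendsto_sum_nat

theorem circleMean_two_of_hasSum {c : ℕ → ℂ} (hc : Summable fun n => ‖c n‖) {r : ℝ} {f : 𝔻 → ℂ}
    (hg : ∀ θ, HasSum (fun n => c n * circleMap 0 1 θ ^ n) (discExt f (circleMap 0 r θ)))
    (hcont : Continuous fun θ => discExt f (circleMap 0 r θ)) :
    circleMean 2 r f = ENNReal.ofReal (∑' n, ‖c n‖ ^ 2) := by
  rw [← integral_norm_sq_of_hasSum hc hg, circleMean_eq_lintegral,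
    ofReal_integral_eq_lintegral_ofReal]
  · refine lintegral_congr fun θ => ?_
    rw [ENNReal.ofReal_pow (norm_nonneg _), ofReal_norm]
    exact_mod_cast ENNReal.rpow_natCast _ 2
  · refine (Integrable.of_bound (C := (∑' n, ‖c n‖) ^ 2)
      (hcont.norm.pow 2).aestronglyMeasurable (.of_forall fun θ => ?_))
    rw [norm_pow, norm_norm]
    gcongr
    refine le_of_tendsto (hg θ).tendsto_sum_nat.norm (.of_forall fun N => ?_)
    refine (norm_sum_le _ _).trans (le_trans (Finset.sum_le_sum fun i _ => ?_)
        (hc.sum_le_tsum (Finset.range N) fun _ _ => norm_nonneg _))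
    simp
  · exact .of_forall fun θ => by positivity

theorem circleMap_eq_mul (r θ : ℝ) : circleMap 0 r θ = r * circleMap 0 1 θ := by
  simp [circleMap]

theorem IsHolomorphicOnDisc.continuous_circleMap {f : 𝔻 → ℂ} (hf : IsHolomorphicOnDisc f) {r : ℝ}
    (hr : r ∈ Set.Ioo (0 : ℝ) 1) : Continuous fun θ => discExt f (circleMap 0 r θ) :=
  hf.continuousOn.comp_continuous (_root_.continuous_circleMap 0 r) (circleMap_mem_unitBall hr)

/-- The dilation `z ↦ f (ρ z)`. -/
noncomputable def dilate (ρ : ℝ) (f : 𝔻 → ℂ) : 𝔻 → ℂ := fun z => discExt f (ρ * z)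

theorem dilate_apply (ρ : ℝ) (f : 𝔻 → ℂ) (z : 𝔻) : dilate ρ f z = discExt f (ρ * z) := rfl

theorem mapsTo_ofReal_mul_ball {ρ : ℝ} (hρ : 0 < ρ) :
    Set.MapsTo (fun z : ℂ => ρ * z) (Metric.ball 0 ρ⁻¹) (Metric.ball 0 1) := fun z hz => by
  rw [mem_ball_zero_iff] at hz ⊢
  rw [norm_mul, Complex.norm_real, Real.norm_of_nonneg hρ.le]
  have := mul_lt_mul_of_pos_left hz hρ
  rwa [mul_inv_cancel₀ hρ.ne'] at this

theorem differentiableOn_discExt_mul {f : 𝔻 → ℂ} (hf : IsHolomorphicOnDisc f) {ρ : ℝ}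
    (hρ : 0 < ρ) :
    DifferentiableOn ℂ (fun z => discExt f (ρ * z)) (Metric.ball 0 ρ⁻¹) :=
  DifferentiableOn.comp hf (by fun_prop) (mapsTo_ofReal_mul_ball hρ)

theorem IsHolomorphicOnDisc.dilate {f : 𝔻 → ℂ} (hf : IsHolomorphicOnDisc f) {ρ : ℝ}
    (hρ : ρ ∈ Set.Ioo (0 : ℝ) 1) : IsHolomorphicOnDisc (dilate ρ f) :=
  .of_eq ((differentiableOn_discExt_mul hf hρ.1).mono
    (Metric.ball_subset_ball (one_le_inv₀ hρ.1 |>.2 hρ.2.le))) (dilate_apply ρ f)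

theorem discExt_dilate_circleMap {f : 𝔻 → ℂ} (ρ : ℝ) {r : ℝ} (hr : r ∈ Set.Ioo (0 : ℝ) 1) (θ : ℝ) :
    discExt (dilate ρ f) (circleMap 0 r θ) = discExt f (circleMap 0 (ρ * r) θ) := by
  have := eqOn_discExt (g := fun z => discExt f (ρ * z)) (dilate_apply ρ f) (circleMap_mem_unitBall hr θ)
  rw [this, circleMap_eq_mul r, circleMap_eq_mul (ρ * r), Complex.ofReal_mul, mul_assoc]

theorem circleMean_dilate {f : 𝔻 → ℂ} (p ρ : ℝ) {r : ℝ} (hr : r ∈ Set.Ioo (0 : ℝ) 1) :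
    circleMean p r (dilate ρ f) = circleMean p (ρ * r) f := by
  simp_rw [circleMean, discExt_dilate_circleMap ρ hr]

theorem discExt_sub (f g : 𝔻 → ℂ) {z : ℂ} (hz : z ∈ Metric.ball (0 : ℂ) 1) :
    discExt (fun z => f z - g z) z = discExt f z - discExt g z :=
  eqOn_discExt (g := fun z => discExt f z - discExt g z) (fun z => by simp) hz

/-- The mean square distance to a dilation is controlled by a square summable sequence. -/
theorem exists_summable_circleMean_two_le {f : 𝔻 → ℂ} (hf : IsHolomorphicOnDisc f) {B : ℝ}
    (hB : ∀ r ∈ Set.Ioo (0 : ℝ) 1, circleMean 2 r f ≤ ENNReal.ofReal B) :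
    ∃ b : ℕ → ℝ, (∀ n, 0 ≤ b n) ∧ Summable b ∧ ∀ ρ ∈ Set.Ioo (0 : ℝ) 1, ∀ r ∈ Set.Ioo (0 : ℝ) 1,
      circleMean 2 r (fun z => dilate ρ f z - f z) ≤
        ENNReal.ofReal (∑' n, b n * (1 - ρ ^ n) ^ 2) := by
  set a : ℕ → ℂ := fun n => ((n.factorial : ℂ)⁻¹) * iteratedDeriv n (discExt f) 0 with ha
  have hsum : ∀ r ∈ Set.Ioo (0 : ℝ) 1, ∀ θ : ℝ,
      HasSum (fun n => a n * (r : ℂ) ^ n * circleMap 0 1 θ ^ n) (discExt f (circleMap 0 r θ)) := by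
    intro r hr θ
    have := Complex.hasSum_taylorSeries_on_ball (r := 1) hf (circleMap_mem_unitBall hr θ)
    refine this.congr_fun fun n => ?_
    rw [circleMap_eq_mul r]
    simp only [ha, smul_eq_mul, sub_zero, mul_pow]
    ring
  have habs : ∀ r ∈ Set.Ioo (0 : ℝ) 1, Summable fun n => ‖a n * (r : ℂ) ^ n‖ := by
    intro r hr
    simpa using (hsum r hr 0).summable.norm
  have hsq : ∀ x : ℂ, 0 ≤ ‖x‖ ^ 2 := fun x => by positivity
  have hB0 : ∀ r ∈ Set.Ioo (0 : ℝ) 1, ∀ N,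
      ∑ n ∈ Finset.range N, ‖a n * (r : ℂ) ^ n‖ ^ 2 ≤ max B 0 := by
    intro r hr N
    have h := hB r hr
    rw [circleMean_two_of_hasSum (habs r hr) (hsum r hr) (hf.continuous_circleMap hr)] at h
    refine ((summable_norm_sq (habs r hr)).sum_le_tsum (Finset.range N) fun _ _ => hsq _).trans ?_
    rw [← ENNReal.ofReal_le_ofReal_iff (le_max_right _ _)]
    exact h.trans (ENNReal.ofReal_le_ofReal (le_max_left _ _))
  -- Letting r → 1 in finite partial sums removes the factors r^n, so the Taylor coefficients are
  -- square summable.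
  have hB1 : ∀ N, ∑ n ∈ Finset.range N, ‖a n‖ ^ 2 ≤ max B 0 := by
    intro N
    have hc : Tendsto (fun r : ℝ => ∑ n ∈ Finset.range N, ‖a n * (r : ℂ) ^ n‖ ^ 2) (𝓝[<] 1)
        (𝓝 (∑ n ∈ Finset.range N, ‖a n * ((1 : ℝ) : ℂ) ^ n‖ ^ 2)) :=
      (Continuous.tendsto (by fun_prop) 1).mono_left nhdsWithin_le_nhds
    simp only [Complex.ofReal_one, one_pow, mul_one] at hc
    exact le_of_tendsto hc (by
      filter_upwards [Ioo_mem_nhdsLT zero_lt_one] with r hr using hB0 r hr N)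
  have hs : Summable fun n => ‖a n‖ ^ 2 := summable_of_sum_range_le (fun n => hsq _) hB1
  refine ⟨fun n => ‖a n‖ ^ 2, fun n => hsq _, hs, fun ρ hρ r hr => ?_⟩
  have hρr : ρ * r ∈ Set.Ioo (0 : ℝ) 1 :=
    ⟨mul_pos hρ.1 hr.1, mul_lt_one_of_nonneg_of_lt_one_left hρ.1.le hρ.2 hr.2.le⟩
  have hpow : ∀ n, |ρ ^ n - 1| = 1 - ρ ^ n := fun n => by
    rw [abs_sub_comm, abs_of_nonneg (sub_nonneg.2 (pow_le_one₀ hρ.1.le hρ.2.le))]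
  have hd : ∀ θ, HasSum (fun n => a n * (r : ℂ) ^ n * ((ρ : ℂ) ^ n - 1) * circleMap 0 1 θ ^ n)
      (discExt (fun z => dilate ρ f z - f z) (circleMap 0 r θ)) := fun θ => by
    rw [discExt_sub _ _ (circleMap_mem_unitBall hr θ), discExt_dilate_circleMap ρ hr]
    refine ((hsum _ hρr θ).sub (hsum r hr θ)).congr_fun fun n => ?_
    push_cast
    ring
  have hnorm : ∀ n, ‖a n * (r : ℂ) ^ n * ((ρ : ℂ) ^ n - 1)‖ = ‖a n * (r : ℂ) ^ n‖ * (1 - ρ ^ n) :=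
    fun n => by
      rw [norm_mul, ← hpow, ← Real.norm_eq_abs, ← Complex.norm_real]
      push_cast; rfl
  have h01 : ∀ n, 0 ≤ 1 - ρ ^ n ∧ 1 - ρ ^ n ≤ 1 := fun n =>
    ⟨sub_nonneg.2 (pow_le_one₀ hρ.1.le hρ.2.le), by linarith [pow_pos hρ.1 n]⟩
  have hda : Summable fun n => ‖a n * (r : ℂ) ^ n * ((ρ : ℂ) ^ n - 1)‖ := by
    refine .of_nonneg_of_le (fun n => norm_nonneg _) (fun n => ?_) (habs r hr)
    rw [hnorm]
    exact mul_le_of_le_one_right (norm_nonneg _) (h01 n).2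
  rw [circleMean_two_of_hasSum hda hd]
  · refine ENNReal.ofReal_le_ofReal (Summable.tsum_le_tsum (fun n => ?_) (summable_norm_sq hda) ?_)
    · rw [hnorm, mul_pow, norm_mul]
      gcongr
      rw [norm_pow, Complex.norm_real, Real.norm_of_nonneg hr.1.le]
      exact pow_le_pow_left₀ (by have := hr.1; positivity)
        (mul_le_of_le_one_right (norm_nonneg _) (pow_le_one₀ hr.1.le hr.2.le)) 2
    · refine .of_nonneg_of_le (fun n => by positivity) (fun n => ?_) hs
      exact mul_le_of_le_one_right (hsq _) (pow_le_one₀ (h01 n).1 (h01 n).2)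
  · have := ((hf.dilate hρ).continuous_circleMap hr).sub (hf.continuous_circleMap hr)
    refine this.congr fun θ => ?_
    rw [discExt_sub _ _ (circleMap_mem_unitBall hr θ)]; rfl

/-- Split by size. If t = max(x, y) is large, u ≤ 2t and p < q give u^p ≤ η t^q. If u ≤ η^{1/p},
then u^p ≤ η. Otherwise u lies between δ and 2K, and a multiple of u² dominates. This works on
either side of p = 2. -/
theorem exists_rpow_le_add {p q η : ℝ} (hp : 0 < p) (hpq : p < q) (hη : 0 < η) :
    ∃ C : ℝ, 0 ≤ C ∧ ∀ x y u : ℝ, 0 ≤ x → 0 ≤ y → 0 ≤ u → u ≤ x + y →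
      u ^ p ≤ η + C * u ^ (2 : ℝ) + η * (x ^ q + y ^ q) := by
  obtain ⟨K, hK0, hK⟩ : ∃ K : ℝ, 0 < K ∧ ∀ t, K ≤ t → (2 * t) ^ p ≤ η * t ^ q := by
    have ho := (tendsto_rpow_neg_atTop (sub_pos.2 hpq)).const_mul (2 ^ p)
    rw [mul_zero] at ho
    obtain ⟨K, hK⟩ := (ho.eventually_le_const hη).exists_forall_of_atTop
    refine ⟨max K 1, by positivity, fun t ht => ?_⟩
    have ht0 : 0 < t := zero_lt_one.trans_le ((le_max_right _ _).trans ht)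
    have := mul_le_mul_of_nonneg_right (hK t ((le_max_left _ _).trans ht))
      (Real.rpow_nonneg ht0.le q)
    rwa [mul_assoc, ← Real.rpow_add ht0, neg_sub, sub_add_cancel,
      ← Real.mul_rpow zero_le_two ht0.le] at this
  set δ : ℝ := η ^ (1 / p) with hδ
  have hδ0 : 0 < δ := by positivity
  refine ⟨(2 * K) ^ p / δ ^ (2 : ℝ), by positivity, fun x y u hx hy hu huxy => ?_⟩
  set t := max x y
  have ht : u ≤ 2 * t := by linarith [le_max_left x y, le_max_right x y]
  have ht0 : 0 ≤ t := hx.trans (le_max_left x y)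
  have hxq : 0 ≤ x ^ q := by positivity
  have hyq : 0 ≤ y ^ q := by positivity
  have htq : t ^ q ≤ x ^ q + y ^ q := by
    rcases max_choice x y with h | h <;> simp only [t, h] <;> linarith
  have hC : 0 ≤ (2 * K) ^ p / δ ^ (2 : ℝ) * u ^ (2 : ℝ) := by positivity
  have hmid : 0 ≤ η * (x ^ q + y ^ q) := by positivity
  rcases le_total K t with hKt | hKt
  · have h1 : u ^ p ≤ (2 * t) ^ p := Real.rpow_le_rpow hu ht hp.le
    have h2 := mul_le_mul_of_nonneg_left htq hη.le
    linarith [hK t hKt]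
  · rcases le_total u δ with hud | hud
    · have h1 : u ^ p ≤ δ ^ p := Real.rpow_le_rpow hu hud hp.le
      rw [hδ, ← Real.rpow_mul hη.le, one_div_mul_cancel hp.ne', Real.rpow_one] at h1
      linarith
    · have h1 : u ^ p ≤ (2 * K) ^ p := Real.rpow_le_rpow hu (by linarith) hp.le
      have h2 : (2 * K) ^ p ≤ (2 * K) ^ p / δ ^ (2 : ℝ) * u ^ (2 : ℝ) := by
        rw [div_mul_eq_mul_div, le_div_iff₀ (by positivity)]
        gcongr
      linarith

theorem circleMean_le_add {p q η C r : ℝ} (hp : 0 < p) (hq : 0 < q) (hη : 0 ≤ η) (hC : 0 ≤ C)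
    (h : ∀ x y u : ℝ, 0 ≤ x → 0 ≤ y → 0 ≤ u → u ≤ x + y →
      u ^ p ≤ η + C * u ^ (2 : ℝ) + η * (x ^ q + y ^ q))
    {f g : 𝔻 → ℂ} (hf : IsHolomorphicOnDisc f) (hg : IsHolomorphicOnDisc g)
    (hr : r ∈ Set.Ioo (0 : ℝ) 1) :
    circleMean p r (fun z => f z - g z) ≤ ENNReal.ofReal η +
      ENNReal.ofReal C * circleMean 2 r (fun z => f z - g z) +
      ENNReal.ofReal η * (circleMean q r f + circleMean q r g) := by
  have hfc := hf.continuous_circleMap hr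
  have hgc := hg.continuous_circleMap hr
  have hd : ∀ θ, discExt (fun z => f z - g z) (circleMap 0 r θ) =
      discExt f (circleMap 0 r θ) - discExt g (circleMap 0 r θ) := fun θ =>
    discExt_sub _ _ (circleMap_mem_unitBall hr θ)
  simp only [circleMean_eq_lintegral, hd]
  have hme : ∀ (s : ℝ) (k : ℝ → ℂ), Continuous k → Measurable fun θ => ‖k θ‖ₑ ^ s :=
    fun s k hk => hk.measurable.enorm.pow_const s
  have h1 := hme q _ hfc
  have h2 := hme q _ hgc
  have h3 : Measurable fun θ =>
      ‖discExt f (circleMap 0 r θ) - discExt g (circleMap 0 r θ)‖ₑ ^ (2 : ℝ) :=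
    hme 2 _ (hfc.sub hgc)
  calc _ ≤ ∫⁻ θ, (ENNReal.ofReal η + ENNReal.ofReal C *
        ‖discExt f (circleMap 0 r θ) - discExt g (circleMap 0 r θ)‖ₑ ^ (2 : ℝ) +
        ENNReal.ofReal η * (‖discExt f (circleMap 0 r θ)‖ₑ ^ q +
          ‖discExt g (circleMap 0 r θ)‖ₑ ^ q)) ∂angleMeasure := by
        refine lintegral_mono fun θ => ?_
        have := h _ _ _ (norm_nonneg (discExt f (circleMap 0 r θ)))
          (norm_nonneg (discExt g (circleMap 0 r θ))) (norm_nonneg _) (norm_sub_le _ _)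
        simp only [← ofReal_norm]
        rw [ENNReal.ofReal_rpow_of_nonneg (norm_nonneg _) hp.le,
          ENNReal.ofReal_rpow_of_nonneg (norm_nonneg _) zero_le_two,
          ENNReal.ofReal_rpow_of_nonneg (norm_nonneg _) hq.le,
          ENNReal.ofReal_rpow_of_nonneg (norm_nonneg _) hq.le,
          ← ENNReal.ofReal_add (by positivity) (by positivity), ← ENNReal.ofReal_mul hC,
          ← ENNReal.ofReal_mul hη, ← ENNReal.ofReal_add (by positivity) (by positivity),
          ← ENNReal.ofReal_add (by positivity) (by positivity)]
        exact ENNReal.ofReal_le_ofReal this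
    _ = _ := by
        have h4 : Measurable fun θ => ‖discExt f (circleMap 0 r θ)‖ₑ ^ q +
          ‖discExt g (circleMap 0 r θ)‖ₑ ^ q := h1.add h2
        rw [lintegral_add_right _ (h4.const_mul _), lintegral_add_left measurable_const,
          lintegral_const, measure_univ, mul_one, lintegral_const_mul _ h3,
          lintegral_const_mul _ h4, lintegral_add_left h1]

/-- Pointwise t^p ≤ 1 + t^q, integrated against a probability measure, suffices in place of Hölder's
inequality. -/
theorem circleMean_le_one_add {p q : ℝ} (hp : 0 ≤ p) (hpq : p ≤ q) (r : ℝ) (f : 𝔻 → ℂ) :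
    circleMean p r f ≤ 1 + circleMean q r f := by
  rw [circleMean_eq_lintegral, circleMean_eq_lintegral]
  calc _ ≤ ∫⁻ θ, (1 + ‖discExt f (circleMap 0 r θ)‖ₑ ^ q) ∂angleMeasure := by
        refine lintegral_mono fun θ => ?_
        rcases le_total (‖discExt f (circleMap 0 r θ)‖ₑ) 1 with h | h
        · exact (ENNReal.rpow_le_one h hp).trans le_self_add
        · exact (ENNReal.rpow_le_rpow_of_exponent_le h hpq).trans le_add_self
    _ = _ := by rw [lintegral_add_left measurable_const, lintegral_const, measure_univ, mul_one]

/-- As q ≥ 2, Parseval gives mean-square convergence uniformly in the radius. The H^q bound controls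
the large values, and `exists_rpow_le_add` combines the two into convergence in exponent p < q. -/
theorem tendsto_hardyENorm_dilate_sub {p q : ℝ} (hp : 0 < p) (hpq : p < q) (hq : 2 ≤ q)
    {f : 𝔻 → ℂ} (hf : MemHardy q f) :
    Tendsto (fun ρ : ℝ => hardyENorm p fun z => dilate ρ f z - f z) (𝓝[<] 1) (𝓝 0) := by
  have hq0 : 0 < q := hp.trans hpq
  obtain ⟨B, hB0, hB⟩ : ∃ B : ℝ, 0 ≤ B ∧ ∀ r ∈ Set.Ioo (0 : ℝ) 1,
      circleMean q r f ≤ ENNReal.ofReal B :=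
    ⟨(hardyENorm q f ^ q).toReal, ENNReal.toReal_nonneg, fun r hr => by
      rw [ENNReal.ofReal_toReal (ENNReal.rpow_ne_top_of_nonneg hq0.le hf.2.ne)]
      exact circleMean_le hq0 f hr⟩
  obtain ⟨b, hb0, hb, hbr⟩ := exists_summable_circleMean_two_le hf.1 (B := 1 + B) fun r hr => by
    rw [ENNReal.ofReal_add zero_le_one hB0, ENNReal.ofReal_one]
    exact (circleMean_le_one_add zero_le_two hq r f).trans (add_le_add_right (hB r hr) 1)
  have hS : Tendsto (fun ρ : ℝ => ∑' n, b n * (1 - ρ ^ n) ^ 2) (𝓝[<] 1) (𝓝 0) := by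
    have : Tendsto (fun ρ : ℝ => ∑' n, b n * (1 - ρ ^ n) ^ 2) (𝓝[<] 1)
        (𝓝 (∑' n, b n * (1 - 1 ^ n) ^ 2)) := by
      refine tendsto_tsum_of_dominated_convergence hb (fun n => ?_) ?_
      · exact (Continuous.tendsto (by fun_prop) 1).mono_left nhdsWithin_le_nhds
      · filter_upwards [Ioo_mem_nhdsLT zero_lt_one] with ρ hρ n
        have h0 : 0 ≤ 1 - ρ ^ n := sub_nonneg.2 (pow_le_one₀ hρ.1.le hρ.2.le)
        have h1 : 1 - ρ ^ n ≤ 1 := by linarith [pow_pos hρ.1 n]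
        rw [Real.norm_of_nonneg (mul_nonneg (hb0 n) (by positivity))]
        exact mul_le_of_le_one_right (hb0 n) (pow_le_one₀ h0 h1)
    simpa using this
  rw [ENNReal.tendsto_nhds_zero]
  intro ε hε
  rcases eq_or_ne ε ∞ with rfl | hεt
  · exact .of_forall fun _ => le_top
  have hεp : ε ^ p ≠ ∞ := ENNReal.rpow_ne_top_of_nonneg hp.le hεt
  set e := (ε ^ p).toReal with he
  have he0 : 0 < e := ENNReal.toReal_pos (ENNReal.rpow_pos hε hεt).ne' hεp
  -- Chosen so that η + 2ηB = e/2; the mean-square term takes the other half.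
  set η := e / (2 * (1 + 2 * B)) with hη
  have hη0 : 0 < η := by positivity
  obtain ⟨C, hC0, hC⟩ := exists_rpow_le_add hp hpq hη0
  have hS' := hS.const_mul C
  rw [mul_zero] at hS'
  filter_upwards [Ioo_mem_nhdsLT zero_lt_one, hS'.eventually_le_const (half_pos he0)] with ρ hρ hCS
  have hS0 : 0 ≤ ∑' n, b n * (1 - ρ ^ n) ^ 2 := tsum_nonneg fun n => mul_nonneg (hb0 n) (sq_nonneg _)
  have hmain : hardyENorm p (fun z => dilate ρ f z - f z) ≤ (ε ^ p) ^ (1 / p) := by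
    refine hardyENorm_le hp fun r hr => ?_
    have hρr : ρ * r ∈ Set.Ioo (0 : ℝ) 1 :=
      ⟨mul_pos hρ.1 hr.1, mul_lt_one_of_nonneg_of_lt_one_left hρ.1.le hρ.2 hr.2.le⟩
    refine (circleMean_le_add hp hq0 hη0.le hC0 hC (hf.1.dilate hρ) hf.1 hr).trans ?_
    rw [circleMean_dilate q ρ hr, ← ENNReal.ofReal_toReal hεp, ← he]
    calc _ ≤ ENNReal.ofReal η + ENNReal.ofReal C * ENNReal.ofReal (∑' n, b n * (1 - ρ ^ n) ^ 2) +
          ENNReal.ofReal η * (ENNReal.ofReal B + ENNReal.ofReal B) := by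
          gcongr
          · exact hbr ρ hρ r hr
          · exact hB _ hρr
          · exact hB _ hr
      _ = ENNReal.ofReal (η + C * (∑' n, b n * (1 - ρ ^ n) ^ 2) + η * (B + B)) := by
          rw [← ENNReal.ofReal_mul hC0, ← ENNReal.ofReal_add hB0 hB0, ← ENNReal.ofReal_mul hη0.le,
            ← ENNReal.ofReal_add hη0.le (by positivity),
            ← ENNReal.ofReal_add (by positivity) (by positivity)]
      _ ≤ ENNReal.ofReal e := by
          refine ENNReal.ofReal_le_ofReal ?_
          have : η * (1 + 2 * B) = e / 2 := by rw [hη]; field_simp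
          linarith
  rwa [← ENNReal.rpow_mul, mul_one_div_cancel hp.ne', ENNReal.rpow_one] at hmain

end Dilation

/-! ### Roots of zero-free functions and the main theorem. -/

section Main

open Filter Topology

theorem circleMean_pow (p : ℝ) {r : ℝ} (hr : r ∈ Set.Ioo (0 : ℝ) 1) (f : 𝔻 → ℂ) (j : ℕ) :
    circleMean p r (fun z => f z ^ j) = circleMean (j * p) r f := by
  have h : ∀ θ, discExt (fun z => f z ^ j) (circleMap 0 r θ) = discExt f (circleMap 0 r θ) ^ j :=
    fun θ => eqOn_discExt (f := fun z => f z ^ j) (g := fun z => discExt f z ^ j)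
      (fun z => by simp) (circleMap_mem_unitBall hr θ)
  simp only [circleMean, h, enorm_pow, ENNReal.rpow_mul, ENNReal.rpow_natCast]

theorem MemHardy.of_circleMean_le {p : ℝ} (hp : 0 < p) {f : 𝔻 → ℂ} (hf : IsHolomorphicOnDisc f)
    {a : ℝ≥0∞} (ha : a ≠ ∞) (h : ∀ r ∈ Set.Ioo (0 : ℝ) 1, circleMean p r f ≤ a) : MemHardy p f :=
  ⟨hf, (hardyENorm_le hp h).trans_lt
    (ENNReal.rpow_ne_top_of_nonneg (by positivity) ha).lt_top⟩

theorem MemHardy.pow {p q : ℝ} (hp : 0 < p) (hq : 0 < q) {f : 𝔻 → ℂ} (hf : MemHardy q f) {j : ℕ}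
    (hj : j * p ≤ q) : MemHardy p (fun z => f z ^ j) := by
  refine .of_circleMean_le hp (.of_eq (DifferentiableOn.pow hf.1 j) fun z => by simp)
    (a := 1 + hardyENorm q f ^ q)
    (ENNReal.add_ne_top.2 ⟨ENNReal.one_ne_top, ENNReal.rpow_ne_top_of_nonneg hq.le hf.2.ne⟩)
    fun r hr => ?_
  rw [circleMean_pow p hr]
  exact (circleMean_le_one_add (by positivity) hj r f).trans
    (add_le_add_right (circleMean_le hq f hr) 1)

theorem HardySpace.tendsto_of_hardyENorm {p : ℝ} {ι : Type*} {l : Filter ι} {u : ι → HardySpace p}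
    {f : HardySpace p} (h : Tendsto (fun i => hardyENorm p fun z => u i z - f z) l (𝓝 0)) :
    Tendsto u l (𝓝 f) := by
  refine tendsto_nhds.2 fun U hU hfU => ?_
  obtain ⟨ε, hε, hεU⟩ := hU f hfU
  filter_upwards [h.eventually_lt_const hε] with i hi using hεU _ hi

/-- A nowhere vanishing holomorphic function on a disc has a holomorphic logarithm. -/
theorem DifferentiableOn.exists_eq_exp_of_ball {G : ℂ → ℂ} {R : ℝ} (hR : 0 < R)
    (hG : DifferentiableOn ℂ G (Metric.ball 0 R)) (h0 : ∀ z ∈ Metric.ball (0 : ℂ) R, G z ≠ 0) :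
    ∃ k : ℂ → ℂ, DifferentiableOn ℂ k (Metric.ball 0 R) ∧
      ∀ z ∈ Metric.ball (0 : ℂ) R, G z = Complex.exp (k z) := by
  have hd : DifferentiableOn ℂ (fun z => _root_.deriv G z / G z) (Metric.ball 0 R) :=
    (hG.deriv Metric.isOpen_ball).fun_div hG h0
  obtain ⟨k, hk0, hk⟩ := hd.isExactOn_ball.with_val_at 0 (Complex.log (G 0))
  have hc : ∀ z ∈ Metric.ball (0 : ℂ) R, HasDerivAt (fun z => G z * Complex.exp (-k z)) 0 z := by
    intro z hz
    have := (hG.differentiableAt (Metric.isOpen_ball.mem_nhds hz)).hasDerivAt.mul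
      ((hk z hz).neg.cexp)
    refine this.congr_deriv ?_
    field_simp [h0 z hz]
    ring
  have h00 : (0 : ℂ) ∈ Metric.ball (0 : ℂ) R := Metric.mem_ball_self hR
  refine ⟨k, fun z hz => (hk z hz).differentiableAt.differentiableWithinAt, fun z hz => ?_⟩
  have := Metric.isOpen_ball.is_const_of_deriv_eq_zero (convex_ball (0 : ℂ) R).isPreconnected
    (fun z hz => (hc z hz).differentiableAt.differentiableWithinAt)
    (fun z hz => (hc z hz).deriv) hz h00
  simp only [hk0, Complex.exp_neg, Complex.exp_log (h0 0 h00), mul_inv_cancel₀ (h0 0 h00)] at this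
  have he := Complex.exp_ne_zero (k z)
  field_simp at this
  exact this

/-- A bounded holomorphic function as an element of the Hardy space. -/
noncomputable def hInfty.toHardy {p : ℝ} (hp : 0 < p) (a : hInfty) : HardySpace p :=
  ⟨fun z => hInfty.eval z a, .of_bounded hp a.2 fun z => hInfty.norm_eval_le z a⟩

theorem hInfty.toHardy_apply {p : ℝ} (hp : 0 < p) (a : hInfty) (z : 𝔻) :
    hInfty.toHardy hp a z = hInfty.eval z a := rfl

end Main

theorem mainTheorem7 (p : ℝ) (hp : 0 < p) (F : HardySpace p → ℂ) (hF : Continuous F)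
    (hrange : ∀ f : HardySpace p, F f ∈ Set.range (fun z : 𝔻 => f z))
    (hmul : ∀ (f g : HardySpace p) (hfg : MemHardy p (fun z => f z * g z)),
      F ⟨fun z => f z * g z, hfg⟩ = F f * F g) :
    ∃ w : 𝔻, ∀ f : HardySpace p, (∀ z : 𝔻, f z ≠ 0) → F f = f w := by
  have hmul' : ∀ f g h : HardySpace p, (∀ z, h z = f z * g z) → F h = F f * F g := by
    intro f g h hz
    have he : h.toFun = fun z => f z * g z := funext hz
    rw [← hmul f g (he ▸ h.mem)]
    exact congrArg F (HardySpace.ext he)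
  obtain ⟨χ, hχz, hχe⟩ := hInfty.exists_algHom (fun a => F (hInfty.toHardy hp a))
    (fun a b => hmul' _ _ _ fun z => by simp only [hInfty.toHardy_apply, map_mul])
    (fun a => by
      obtain ⟨z, hz⟩ := hrange (hInfty.toHardy hp a)
      exact ⟨z, hz.symm⟩)
  obtain ⟨w, hw⟩ := hInfty.exists_eval χ hχz
  refine ⟨w, fun f hf0 => ?_⟩
  obtain ⟨k, hk, hfk⟩ := DifferentiableOn.exists_eq_exp_of_ball one_pos f.mem.1 fun z hz => by
    lift z to 𝔻 using by simpa using hz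
    simpa using hf0 z
  have hfk' : ∀ z : 𝔻, f z = Complex.exp (k z) := fun z => by
    rw [← hfk z (by simpa using z.norm_lt_one), discExt_coe]
  -- The 2/p secures np ≥ 2 and the extra 1 secures np > p.
  obtain ⟨n, hn⟩ := exists_nat_gt (2 / p + 1)
  have hn1 : (1 : ℝ) < n := by linarith [div_pos two_pos hp]
  have hn0 : (n : ℂ) ≠ 0 := by
    have : (n : ℝ) ≠ 0 := by linarith
    exact_mod_cast this
  have hq2 : 2 ≤ n * p := by
    rw [← div_le_iff₀ hp]; linarith
  have hpq : p < n * p := lt_mul_of_one_lt_left hp hn1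
  have hq0 : 0 < n * p := hp.trans hpq
  set h : 𝔻 → ℂ := fun z => Complex.exp (k z / n) with hh
  have hhol : IsHolomorphicOnDisc h :=
    .of_eq (g := fun z => Complex.exp (k z / n)) (hk.div_const _).cexp fun _ => rfl
  have hpow : ∀ z, f z = h z ^ n := fun z => by
    rw [hfk', hh, ← Complex.exp_nat_mul, mul_div_cancel₀ _ hn0]
  have hmem : MemHardy (n * p) h := by
    refine .of_circleMean_le hq0 hhol (ENNReal.rpow_ne_top_of_nonneg hp.le f.mem.2.ne)
      fun r hr => ?_
    rw [← circleMean_pow p hr h n, ← funext hpow]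
    exact circleMean_le hp _ hr
  -- Multiplicativity of F needs every intermediate power in H^p; jp ≤ np provides this for j ≤ n.
  let H : ∀ j : ℕ, j ≤ n → HardySpace p := fun j hj =>
    ⟨fun z => h z ^ j, hmem.pow hp hq0 (by gcongr)⟩
  have hn1' : 1 ≤ n := by exact_mod_cast hn1.le
  have hFpow : ∀ j (_ : 1 ≤ j) (hj : j ≤ n), F (H j hj) = F (H 1 hn1') ^ j := by
    intro j hj1
    induction j, hj1 using Nat.le_induction with
    | base => intro _; rw [pow_one]
    | succ j _ ih =>
      intro hj
      rw [pow_succ, ← ih (Nat.le_of_succ_le hj)]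
      exact hmul' _ _ _ fun z => by
        change h z ^ (j + 1) = h z ^ j * h z ^ 1
        rw [pow_succ, pow_one]
  have hFh : F (H 1 hn1') = h w := by
    obtain ⟨ρ, -, hρ, hρ1⟩ := exists_seq_strictMono_tendsto' (zero_lt_one' ℝ)
    have hrep : ∀ m, ∃ u : HardySpace p, u.toFun = dilate (ρ m) h ∧
        F u = discExt h (ρ m * w) := fun m => by
      have hρw : ∀ z : 𝔻, (ρ m : ℂ) * z ∈ Metric.ball (0 : ℂ) 1 := fun z => by
        rw [mem_ball_zero_iff, norm_mul, Complex.norm_real, Real.norm_of_nonneg (hρ m).1.le]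
        exact mul_lt_one_of_nonneg_of_lt_one_left (hρ m).1.le (hρ m).2 z.norm_lt_one.le
      have hK : DifferentiableOn ℂ (fun z => k (ρ m * z) / n) (Metric.ball 0 (ρ m)⁻¹) :=
        (hk.comp (by fun_prop) (mapsTo_ofReal_mul_ball (hρ m).1)).div_const _
      have hR := (one_lt_inv₀ (hρ m).1).2 (hρ m).2
      obtain ⟨a, ha⟩ := hInfty.exists_restrict hR hK
      have hval : ∀ z : 𝔻, Complex.exp (k (ρ m * z) / n) = discExt h (ρ m * z) := fun z =>
        (eqOn_discExt (f := h) (g := fun z => Complex.exp (k z / n)) (fun _ => rfl) (hρw z)).symm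
      -- The dilate of h is exp of a = k(ρz)/n, which is holomorphic on the disc of radius 1/ρ > 1,
      -- so χ(a) is evaluation at w.
      refine ⟨hInfty.toHardy hp (NormedSpace.exp a), funext fun z => ?_, ?_⟩
      · rw [hInfty.toHardy_apply, hInfty.eval_exp, ha, hval, dilate_apply]
      · rw [hχe, hw _ _ a hR hK ha, hval]
    choose u hu hFu using hrep
    have hconv : Filter.Tendsto u Filter.atTop (nhds (H 1 hn1')) := by
      refine HardySpace.tendsto_of_hardyENorm ?_
      have := (tendsto_hardyENorm_dilate_sub hp hpq hq2 hmem).comp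
        (tendsto_nhdsWithin_iff.2 ⟨hρ1, .of_forall fun m => (hρ m).2⟩)
      refine this.congr fun m => ?_
      simp only [Function.comp_apply, hu, H, pow_one]
    have hlim1 := (hF.tendsto _).comp hconv
    have hlim2 : Filter.Tendsto (F ∘ u) Filter.atTop (nhds (h w)) := by
      have hc : ContinuousAt (discExt h) w := (hhol.differentiableAt
        (Metric.isOpen_ball.mem_nhds (by simpa using w.norm_lt_one))).continuousAt
      have hm : Filter.Tendsto (fun m => (ρ m : ℂ) * w) Filter.atTop (nhds (w : ℂ)) := by
        simpa using ((Complex.continuous_ofReal.tendsto 1).comp hρ1).mul_const (w : ℂ)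
      have := hc.tendsto.comp hm
      rw [discExt_coe] at this
      exact this.congr fun m => (hFu m).symm
    exact tendsto_nhds_unique hlim1 hlim2
  have hfH : f = H n le_rfl := HardySpace.ext (funext hpow)
  rw [hpow w, ← hFh, ← hFpow n hn1' le_rfl, ← hfH]
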